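/- Let $A$ be a reduced Noetherian ring (commutative with one; for instance, a reduced excellent ring), with total ring of fractions $Q(A)$ and normalization $\overline{A}$, the integral closure of $A$ in $Q(A)$. Let $\mathcal C_A=\operatorname{Ann}_A(\overline A/A)$ be its conductor. A \emph{test ideal} for $A$ is a radical ideal $J\subseteq A$ that contains a non-zerodivisor of $A$ and satisfies $V(\mathcal C_A)\subseteq V(J)$. For an ideal $I$ of $A$, write $\operatorname{Ass}(I)$ for the set of associated primes of the $A$-module $A/I$. For a radical ideal $J\subseteq A$ containing a non-zerodivisor, put $A_0=A$, $J_i=\sqrt{JA_i}$ and $A_{i+1}=\operatorname{End}_{A_i}(J_i)$, where $\operatorname{End}_{A_i}(J_i)$ is identified with the subring $\{x\in Q(A)\mid xJ_i\subseteq J_i\}$ of $Q(A)$, and let $n(A,J)\in\mathbb N\cup\{\infty\}$ be the least $n\ge 0$ with $A_n=A_{n+1}$ ($\infty$ if there is none). Suppose that $A$ is equidimensional (that is, $\dim A/\mathfrak p=\dim A$ for all minimal primes $\mathfrak p$ of $A$) and satisfies Serre's condition $(S_2)$ (that is, $\operatorname{depth} A_P\ge\min\{2,\dim A_P\}$ for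 all $P\in\operatorname{Spec}(A)$). Let $J$ be a test ideal for $A$, and let $J'\subseteq A$ be a radical ideal with $\operatorname{Ass}(J')\subseteq\operatorname{Ass}(J)$ (which forces $J\subseteq J'$, so that $J'$ contains a non-zerodivisor). Then \[ n(A,J')\le n(A,J)<\infty . \] -/

import Mathlib

namespace GLS

/-- The conductor `Ann_A(Ā / A)` of `A` in its normalization `Ā`, the integral closure of `A` in
the total ring of fractions of `A`. -/
noncomputable def conductor (A : Type*) [CommRing A] : Ideal A :=
  Module.annihilator A
    (integralClosure A (FractionRing A) ⧸
      LinearMap.range (Algebra.linearMap A (integralClosure A (FractionRing A))))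

/-- Test ideals for `A`. -/
structure IsTestIdeal {A : Type*} [CommRing A] (J : Ideal A) : Prop where
  exists_nonZeroDivisor : ∃ g ∈ J, g ∈ nonZeroDivisors A
  isRadical : J.IsRadical
  zeroLocus_subset :
    PrimeSpectrum.zeroLocus (conductor A : Set A) ⊆ PrimeSpectrum.zeroLocus (J : Set A)

/-- For an `A`-subalgebra `C` of `Q` and an ideal `J` of `C`, the subring of `Q` consisting of
the elements whose multiplication map is a `C`-linear endomorphism of `J`. If `C` lies in the
total ring of fractions `Q` of `A` and `J` contains a non-zerodivisor of `A`, then every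
endomorphism is of this form for exactly one element (`existsUnique_mem_endSubalgebra`),
and this is `End_C(J)` as a subring of `Q`. -/
def endSubalgebra {A Q : Type*} [CommRing A] [CommRing Q] [Algebra A Q]
    (C : Subalgebra A Q) (J : Ideal C) : Subalgebra A Q where
  carrier := {x | ∃ φ : J →ₗ[C] J, ∀ y : J, ((φ y : C) : Q) = x * ((y : C) : Q)}
  mul_mem' := by
    rintro x x' ⟨φ, hφ⟩ ⟨ψ, hψ⟩
    exact ⟨φ ∘ₗ ψ, fun y => by rw [LinearMap.comp_apply, hφ, hψ, mul_assoc]⟩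
  add_mem' := by
    rintro x x' ⟨φ, hφ⟩ ⟨ψ, hψ⟩
    exact ⟨φ + ψ, fun y => by simp [hφ, hψ, add_mul]⟩
  algebraMap_mem' := fun a =>
    ⟨algebraMap A C a • LinearMap.id, fun y => by simp [Algebra.smul_def]⟩

theorem existsUnique_mem_endSubalgebra {A Q : Type*} [CommRing A] [CommRing Q] [Algebra A Q]
    [IsFractionRing A Q] (C : Subalgebra A Q) (J : Ideal C) (g : A) (hg : g ∈ nonZeroDivisors A)
    (hgJ : algebraMap A C g ∈ J) (φ : J →ₗ[C] J) :
    ∃! x : Q, x ∈ endSubalgebra C J ∧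
      ∀ y : J, ((φ y : C) : Q) = x * ((y : C) : Q) := by
  have hu : IsUnit (algebraMap A Q g) :=
    IsLocalization.map_units Q (⟨g, hg⟩ : nonZeroDivisors A)
  obtain ⟨u, hu⟩ := hu
  have hgc : ((algebraMap A C g : C) : Q) = u := by rw [hu]; rfl
  have key : ∀ y : J, ((φ y : C) : Q)
      = (u⁻¹ : Qˣ) * ((φ ⟨_, hgJ⟩ : C) : Q)
        * ((y : C) : Q) := by
    intro y
    have h1 : (algebraMap A C g) • y = (y : C) • (⟨_, hgJ⟩ : J) := by
      ext; simp [Algebra.smul_def, mul_comm]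
    have h2 := congrArg (fun z : J => ((z : C) : Q)) (congrArg φ h1)
    simp only [map_smul, Submodule.coe_smul, smul_eq_mul, MulMemClass.coe_mul, hgc] at h2
    rw [mul_assoc, Units.eq_inv_mul_iff_mul_eq, h2, mul_comm]
  refine ⟨_, ⟨⟨φ, key⟩, key⟩, ?_⟩
  rintro x ⟨-, hx⟩
  have h := hx ⟨_, hgJ⟩
  simp only [hgc] at h
  rw [h, mul_comm x, Units.inv_mul_cancel_left]

/-- The chain `A₀ = A`, `Aᵢ₊₁ = End_{Aᵢ}(√(J Aᵢ))` of subrings of the total ring of fractions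
of `A`. -/
noncomputable def chain {A : Type*} [CommRing A] (J : Ideal A) :
    ℕ → Subalgebra A (FractionRing A)
  | 0 => ⊥
  | i + 1 => endSubalgebra (chain J i) (J.map (algebraMap A (chain J i))).radical

/-- The number `n(A, J)` of steps: the least `n` with `Aₙ = Aₙ₊₁`
(and `⊤` if there is no such `n`). -/
noncomputable def numSteps {A : Type*} [CommRing A] (J : Ideal A) : ℕ∞ :=
  ⨅ n ∈ {n : ℕ | chain J n = chain J (n + 1)}, (n : ℕ∞)

/-- The depth of a local ring: the supremum of the lengths of the regular sequences in its
maximal ideal. -/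
noncomputable def depth (R : Type*) [CommRing R] [IsLocalRing R] : ℕ∞ :=
  ⨆ rs ∈ {rs : List R | (∀ r ∈ rs, r ∈ IsLocalRing.maximalIdeal R) ∧
    RingTheory.Sequence.IsRegular R rs}, (rs.length : ℕ∞)

/-- Serre's condition `(Sᵢ)`. -/
def SerreS (R : Type*) [CommRing R] (i : ℕ) : Prop :=
  ∀ (P : Ideal R) [P.IsPrime],
    min (i : WithBot ℕ∞) (ringKrullDim (Localization.AtPrime P)) ≤
      (depth (Localization.AtPrime P) : WithBot ℕ∞)

/-- All irreducible components of `Spec R` have the same dimension. -/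
def IsEquidimensional (R : Type*) [CommRing R] : Prop :=
  ∀ p ∈ minimalPrimes R, ringKrullDim (R ⧸ p) = ringKrullDim R

end GLS

namespace GLS

section EndSubalgebra

variable {A Q : Type*} [CommRing A] [CommRing Q] [Algebra A Q]

theorem mem_endSubalgebra_iff {C : Subalgebra A Q} {J : Ideal C} {x : Q} :
    x ∈ endSubalgebra C J ↔ ∀ y ∈ J, ∃ z ∈ J, (z : Q) = x * (y : Q) := by
  constructor
  · rintro ⟨φ, hφ⟩ y hy
    exact ⟨φ ⟨y, hy⟩, (φ ⟨y, hy⟩).2, hφ ⟨y, hy⟩⟩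
  · intro h
    choose f hf hfx using h
    refine ⟨⟨⟨fun y => ⟨f y y.2, hf y y.2⟩, fun y z => ?_⟩, fun c y => ?_⟩, fun y => hfx y y.2⟩
    · ext
      simp [hfx, mul_add]
    · ext
      simp [hfx, mul_left_comm]

theorem le_endSubalgebra (C : Subalgebra A Q) (J : Ideal C) : C ≤ endSubalgebra C J :=
  fun x hx => mem_endSubalgebra_iff.2 fun y hy => ⟨⟨x, hx⟩ * y, J.mul_mem_left _ hy, rfl⟩

theorem endSubalgebra_top (C : Subalgebra A Q) : endSubalgebra C (⊤ : Ideal C) = C := by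
  refine le_antisymm (fun x hx => ?_) (le_endSubalgebra C ⊤)
  obtain ⟨z, -, hz⟩ := mem_endSubalgebra_iff.1 hx 1 trivial
  rw [OneMemClass.coe_one, mul_one] at hz
  exact hz ▸ z.2

/-- A submodule that a unit multiplies into a Noetherian submodule is Noetherian. -/
theorem isNoetherian_of_isUnit_mul_mem {M N : Submodule A Q} [IsNoetherian A N] {u : Q}
    (hu : IsUnit u) (h : ∀ x ∈ M, u * x ∈ N) : IsNoetherian A M := by
  refine isNoetherian_of_injective ((LinearMap.mulLeft A u).restrict h) fun x y hxy => ?_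
  exact Subtype.ext (hu.mul_left_cancel (congrArg Subtype.val hxy))

theorem isNoetherian_of_le {M N : Submodule A Q} [IsNoetherian A N] (h : M ≤ N) :
    IsNoetherian A M :=
  isNoetherian_of_isUnit_mul_mem (N := N) isUnit_one fun x hx => by simpa using h hx

/-- If `J` contains a unit of `Q`, then `End_C(J)` is integral over `A` as soon as `C` is a
Noetherian `A`-module. -/
theorem endSubalgebra_le_integralClosure {C : Subalgebra A Q}
    [IsNoetherian A (Subalgebra.toSubmodule C)] {J : Ideal C} {u : C} (hu : IsUnit (u : Q))
    (huJ : u ∈ J) : endSubalgebra C J ≤ integralClosure A Q := by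
  have : IsNoetherian A (Subalgebra.toSubmodule (endSubalgebra C J)) := by
    refine isNoetherian_of_isUnit_mul_mem (N := Subalgebra.toSubmodule C) hu fun x hx => ?_
    obtain ⟨z, -, hz⟩ := mem_endSubalgebra_iff.1 hx u huJ
    rw [mul_comm, ← hz]
    exact z.2
  exact fun x hx => IsIntegral.of_mem_of_fg _ ((Submodule.fg_top _).1 (this.noetherian _)) x hx

theorem mem_endSubalgebra_of_isIntegral {C : Subalgebra A Q} {J : Ideal C} (hJ : J.IsRadical)
    {x : Q} (hx : IsIntegral A x) (h : ∀ y ∈ J, x * (y : Q) ∈ C) : x ∈ endSubalgebra C J := by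
  refine mem_endSubalgebra_iff.2 fun y hy => ⟨⟨_, h y hy⟩, ?_, rfl⟩
  rw [← hJ.radical, Ideal.radical_eq_sInf, Submodule.mem_sInf]
  rintro p ⟨hJp, hp⟩
  have hxC : IsIntegral C x := hx.tower_top
  obtain ⟨q, -, hq, hqp⟩ := Ideal.exists_ideal_over_prime_of_isIntegral
    (S := integralClosure C Q) p ⊥ (by
      intro z hz
      have hz : algebraMap C (integralClosure C Q) z = 0 := hz
      have hz0 : z = 0 := Subtype.ext (congrArg (algebraMap (integralClosure C Q) Q) hz)
      exact hz0 ▸ p.zero_mem)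
  have hyq : algebraMap C (integralClosure C Q) y ∈ q := by
    rw [← Ideal.mem_comap, hqp]
    exact hJp hy
  rw [← hqp, Ideal.mem_comap]
  exact q.mul_mem_left ⟨x, hxC⟩ hyq

/-- Suppose `t` multiplies `J₂` into `J₁` and `s` multiplies `C₂` into `C₁`. Then `s * t`
multiplies `√(J₂ C₂)` into `√(J₁ C₁)`. -/
theorem exists_mem_radical_map_of_mul_mem {C₁ C₂ : Subalgebra A Q} {J₁ J₂ : Ideal A} {s t : A}
    (ht : ∀ a ∈ J₂, t * a ∈ J₁) (hs : ∀ x ∈ C₂, s • x ∈ C₁) {y : C₂}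
    (hy : y ∈ (J₂.map (algebraMap A C₂)).radical) :
    ∃ z ∈ (J₁.map (algebraMap A C₁)).radical, (z : Q) = (s * t) • (y : Q) := by
  have key : ∀ w ∈ J₂.map (algebraMap A C₂), ∀ c : C₂,
      ∃ z ∈ J₁.map (algebraMap A C₁), (z : Q) = (s * t) • ((c : Q) * (w : Q)) := by
    intro w hw
    induction hw using Submodule.span_induction with
    | mem w hw =>
      obtain ⟨a, ha, rfl⟩ := hw
      intro c
      refine ⟨⟨_, hs c c.2⟩ * algebraMap A C₁ (t * a),
        Ideal.mul_mem_left _ _ (Ideal.mem_map_of_mem _ (ht a ha)), ?_⟩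
      change s • (c : Q) * algebraMap A Q (t * a) = (s * t) • ((c : Q) * algebraMap A Q a)
      simp only [Algebra.smul_def, map_mul]
      ring
    | zero => exact fun c => ⟨0, Ideal.zero_mem _, by simp⟩
    | add v w _ _ hv hw =>
      intro c
      obtain ⟨z, hz, hzv⟩ := hv c
      obtain ⟨z', hz', hzw⟩ := hw c
      exact ⟨z + z', Ideal.add_mem _ hz hz', by simp [hzv, hzw, mul_add]⟩
    | smul d w _ hw =>
      intro c
      obtain ⟨z, hz, hzw⟩ := hw (c * d)
      exact ⟨z, hz, by simp [hzw, mul_assoc]⟩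
  obtain ⟨k, hk⟩ := hy
  obtain ⟨w, hw, hwy⟩ := key _ hk y
  have hmem : (s * t) • (y : Q) ∈ C₁ := by
    rw [mul_comm, mul_smul]
    exact C₁.smul_mem (hs y y.2) t
  refine ⟨⟨_, hmem⟩, ⟨k + 1, ?_⟩, rfl⟩
  have : (⟨_, hmem⟩ : C₁) ^ (k + 1) = algebraMap A C₁ ((s * t) ^ k) * w := by
    ext
    change ((s * t) • (y : Q)) ^ (k + 1) = algebraMap A Q ((s * t) ^ k) * (w : Q)
    rw [hwy]
    simp only [Algebra.smul_def, map_mul, map_pow, SubmonoidClass.coe_pow]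
    ring
  rw [this]
  exact Ideal.mul_mem_left _ _ hw

theorem smul_mem_endSubalgebra_of_mul_mem {C₁ C₂ : Subalgebra A Q} {J₁ J₂ : Ideal A} {s t : A}
    (ht : ∀ a ∈ J₂, t * a ∈ J₁) (hs₁ : ∀ x ∈ C₁, s • x ∈ C₂) (hs₂ : ∀ x ∈ C₂, s • x ∈ C₁)
    {x : Q} (hint : IsIntegral A x)
    (hx : x ∈ endSubalgebra C₁ (J₁.map (algebraMap A C₁)).radical) :
    (s * (s * t)) • x ∈ endSubalgebra C₂ (J₂.map (algebraMap A C₂)).radical := by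
  refine mem_endSubalgebra_of_isIntegral (Ideal.radical_isRadical _) (hint.smul _) fun y hy => ?_
  obtain ⟨z, hz, hzy⟩ := exists_mem_radical_map_of_mul_mem ht hs₂ hy
  obtain ⟨w, -, hwz⟩ := mem_endSubalgebra_iff.1 hx z hz
  have : (s * (s * t)) • x * (y : Q) = s • (w : Q) := by
    rw [hwz, hzy]
    simp only [Algebra.smul_def, map_mul]
    ring
  rw [this]
  exact hs₁ w w.2

end EndSubalgebra

section Chain

variable {A : Type*} [CommRing A]

theorem chain_mono (J : Ideal A) : Monotone (chain J) :=
  monotone_nat_of_le_succ fun _ => le_endSubalgebra _ _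

theorem chain_top (i : ℕ) : chain (⊤ : Ideal A) i = ⊥ := by
  induction i with
  | zero => rfl
  | succ i ih =>
    rw [chain, Ideal.map_top, Ideal.radical_top, endSubalgebra_top, ih]

theorem chain_le_integralClosure
    [IsNoetherian A (Subalgebra.toSubmodule (integralClosure A (FractionRing A)))]
    {J : Ideal A} (hJ : ∃ g ∈ J, g ∈ nonZeroDivisors A) (i : ℕ) :
    chain J i ≤ integralClosure A (FractionRing A) := by
  obtain ⟨g, hgJ, hg⟩ := hJ
  induction i with
  | zero => exact bot_le
  | succ i ih =>
    have : IsNoetherian A (Subalgebra.toSubmodule (chain J i)) :=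
      isNoetherian_of_le (N := Subalgebra.toSubmodule (integralClosure A (FractionRing A))) ih
    exact endSubalgebra_le_integralClosure (u := algebraMap A (chain J i) g)
      (IsLocalization.map_units (FractionRing A) (⟨g, hg⟩ : nonZeroDivisors A))
      (Ideal.le_radical (Ideal.mem_map_of_mem _ hgJ))

/-- If a Noetherian ring has a test ideal, its normalization is a Noetherian module, since a
non-zerodivisor multiplies it into the ring. -/
theorem isNoetherian_integralClosure [IsNoetherianRing A] {J : Ideal A} (hJ : IsTestIdeal J) :
    IsNoetherian A (Subalgebra.toSubmodule (integralClosure A (FractionRing A))) := by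
  obtain ⟨g, hgJ, hg⟩ := hJ.exists_nonZeroDivisor
  obtain ⟨k, hk⟩ : g ∈ (conductor A).radical := by
    rw [← PrimeSpectrum.vanishingIdeal_zeroLocus_eq_radical, PrimeSpectrum.mem_vanishingIdeal]
    exact fun p hp => hJ.zeroLocus_subset hp hgJ
  refine isNoetherian_of_isUnit_mul_mem
    (N := LinearMap.range (Algebra.linearMap A (FractionRing A)))
    (IsLocalization.map_units (FractionRing A) (⟨g ^ k, pow_mem hg k⟩ : nonZeroDivisors A))
    fun x hx => ?_
  have h := Module.mem_annihilator.1 hk (Submodule.Quotient.mk ⟨x, hx⟩)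
  rw [← Submodule.Quotient.mk_smul, Submodule.Quotient.mk_eq_zero] at h
  obtain ⟨a, ha⟩ := h
  refine ⟨a, ?_⟩
  have := congrArg Subtype.val ha
  simpa [Algebra.smul_def] using this

theorem exists_chain_eq_succ
    [IsNoetherian A (Subalgebra.toSubmodule (integralClosure A (FractionRing A)))]
    {J : Ideal A} (hJ : ∃ g ∈ J, g ∈ nonZeroDivisors A) : ∃ n, chain J n = chain J (n + 1) := by
  let B := Subalgebra.toSubmodule (integralClosure A (FractionRing A))
  obtain ⟨n, hn⟩ := monotone_stabilizes_iff_noetherian.2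
    (inferInstance : IsNoetherian A B)
    ⟨fun i => (Subalgebra.toSubmodule (chain J i)).comap B.subtype,
      fun i j hij => Submodule.comap_mono (chain_mono J hij)⟩
  refine ⟨n, le_antisymm (chain_mono J n.le_succ) fun x hx => ?_⟩
  have := (hn (n + 1) n.le_succ).ge
    (show (⟨x, chain_le_integralClosure hJ _ hx⟩ : B) ∈ _ from hx)
  exact this

/-- If `J₁` and `J₂` agree at `P`, then so do their chains. -/
theorem exists_smul_mem_chain
    [IsNoetherian A (Subalgebra.toSubmodule (integralClosure A (FractionRing A)))]
    {J₁ J₂ : Ideal A} (h₁ : ∃ g ∈ J₁, g ∈ nonZeroDivisors A)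
    (h₂ : ∃ g ∈ J₂, g ∈ nonZeroDivisors A) {P : Ideal A} [P.IsPrime] {t : A} (htP : t ∉ P)
    (ht₁ : ∀ a ∈ J₁, t * a ∈ J₂) (ht₂ : ∀ a ∈ J₂, t * a ∈ J₁) (i : ℕ) :
    ∃ s ∉ P, (∀ x ∈ chain J₁ i, s • x ∈ chain J₂ i) ∧ ∀ x ∈ chain J₂ i, s • x ∈ chain J₁ i := by
  induction i with
  | zero => exact ⟨t, htP, fun x hx => Subalgebra.smul_mem _ hx t,
      fun x hx => Subalgebra.smul_mem _ hx t⟩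
  | succ i ih =>
    obtain ⟨s, hsP, hs₁, hs₂⟩ := ih
    refine ⟨s * (s * t), ?_, fun x hx => ?_, fun x hx => ?_⟩
    · simp [Ideal.IsPrime.mul_mem_iff_mem_or_mem, hsP, htP]
    · exact smul_mem_endSubalgebra_of_mul_mem ht₂ hs₁ hs₂ (chain_le_integralClosure h₁ _ hx) hx
    · exact smul_mem_endSubalgebra_of_mul_mem ht₁ hs₂ hs₁ (chain_le_integralClosure h₂ _ hx) hx

end Chain

section SerreS

/-- If the maximal ideal of a local ring is the annihilator of a class modulo a regular element,
then the depth is at most one. -/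
theorem depth_le_one {R : Type*} [CommRing R] [IsLocalRing R] {s b : R}
    (hs : s ∈ nonZeroDivisors R) (hb : ¬ s ∣ b)
    (h : ∀ r ∈ IsLocalRing.maximalIdeal R, s ∣ r * b) : depth R ≤ 1 := by
  refine iSup₂_le fun rs hrs => ?_
  obtain ⟨hmem, hreg⟩ := hrs
  match rs, hmem, hreg with
  | [], _, _ => simp
  | [_], _, _ => simp
  | r₁ :: r₂ :: rs, hmem, hreg =>
    exfalso
    rw [RingTheory.Sequence.isRegular_cons_iff, RingTheory.Sequence.isRegular_cons_iff] at hreg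
    obtain ⟨h₁, h₂, -⟩ := hreg
    obtain ⟨c, hc⟩ := h r₁ (hmem r₁ (by simp))
    obtain ⟨d, hd⟩ := h r₂ (hmem r₂ (by simp))
    have hcd : r₂ * c = r₁ * d := by
      refine (mul_cancel_left_mem_nonZeroDivisors hs).1 ?_
      linear_combination r₁ * hd - r₂ * hc
    have hc0 : (Submodule.Quotient.mk c : QuotSMulTop r₁ R) = 0 := by
      refine h₂ ?_
      simp only [smul_zero]
      rw [← Submodule.Quotient.mk_smul, Submodule.Quotient.mk_eq_zero, smul_eq_mul, hcd]
      exact Submodule.smul_mem_pointwise_smul d r₁ ⊤ trivial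
    rw [Submodule.Quotient.mk_eq_zero] at hc0
    obtain ⟨e, -, he⟩ := hc0
    have he : r₁ * e = c := he
    refine hb ⟨e, h₁ ?_⟩
    change r₁ * b = r₁ * (s * e)
    rw [hc, ← he]
    ring

variable {A : Type*} [CommRing A]

theorem exists_forall_mem_iff_mul_mem [IsNoetherianRing A] {I P : Ideal A}
    (hP : IsAssociatedPrime P (A ⧸ I)) : ∃ b, ∀ r, r ∈ P ↔ r * b ∈ I := by
  obtain ⟨-, b, rfl⟩ := isAssociatedPrime_iff.1 hP
  obtain ⟨b, rfl⟩ := Submodule.Quotient.mk_surjective _ b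
  refine ⟨b, fun r => ?_⟩
  rw [Submodule.mem_colon_singleton, ← Submodule.Quotient.mk_smul, Submodule.mem_bot,
    Submodule.Quotient.mk_eq_zero, smul_eq_mul]

/-- Under `(S₂)`, the associated primes of a regular element have height at most one. -/
theorem SerreS.height_le_one (hS2 : SerreS A 2) {s b : A} (hs : s ∈ nonZeroDivisors A)
    {P : Ideal A} [P.IsPrime] (hP : ∀ r, r ∈ P ↔ s ∣ r * b) : P.height ≤ 1 := by
  have hdepth : depth (Localization.AtPrime P) ≤ 1 := by
    refine depth_le_one (s := algebraMap A _ s) (b := algebraMap A _ b)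
      (IsLocalization.map_nonZeroDivisors_le P.primeCompl _ (Submonoid.mem_map_of_mem _ hs)) ?_ ?_
    · rintro ⟨c, hc⟩
      obtain ⟨⟨c', u⟩, hu⟩ := IsLocalization.surj P.primeCompl c
      have h : algebraMap A (Localization.AtPrime P) (u * b) = algebraMap A _ (s * c') := by
        rw [map_mul, map_mul, ← hu, hc]
        ring
      obtain ⟨v, hv⟩ := (IsLocalization.eq_iff_exists P.primeCompl _).1 h
      refine (v * u).2 ((hP _).2 ⟨v * c', ?_⟩)
      rw [Submonoid.coe_mul]
      linear_combination hv
    · intro r hr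
      obtain ⟨r', u, rfl⟩ := IsLocalization.exists_mk'_eq P.primeCompl r
      rw [IsLocalization.AtPrime.mk'_mem_maximal_iff _ P] at hr
      obtain ⟨c, hc⟩ := (hP r').1 hr
      refine ⟨IsLocalization.mk' _ c u, ?_⟩
      rw [mul_comm, IsLocalization.mul_mk'_eq_mk'_of_mul, IsLocalization.mul_mk'_eq_mk'_of_mul,
        mul_comm, hc]
  have h := hS2 P
  rw [IsLocalization.AtPrime.ringKrullDim_eq_height P (Localization.AtPrime P)] at h
  have h' : min (2 : ℕ∞) P.height ≤ 1 := by
    refine le_trans ?_ hdepth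
    rw [← WithBot.coe_le_coe]
    exact (WithBot.coe_min _ _).trans_le h
  exact (min_le_iff.1 h').resolve_left (by decide)

/-- Under `(S₂)`, an element of the total ring of fractions that belongs to `A_P` for all
primes `P` of height at most one belongs to `A`. -/
theorem SerreS.mem_bot_of_forall_height_le_one [IsNoetherianRing A] (hS2 : SerreS A 2)
    {x : FractionRing A}
    (h : ∀ (P : Ideal A) [P.IsPrime], P.height ≤ 1 →
      ∃ s ∉ P, s • x ∈ (⊥ : Subalgebra A (FractionRing A))) :
    x ∈ (⊥ : Subalgebra A (FractionRing A)) := by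
  obtain ⟨a, s, rfl⟩ := IsLocalization.exists_mk'_eq (nonZeroDivisors A) x
  by_contra hx
  have ha : (Submodule.Quotient.mk a : A ⧸ Ideal.span {(s : A)}) ≠ 0 := by
    rw [Ne, Submodule.Quotient.mk_eq_zero, Ideal.mem_span_singleton]
    rintro ⟨c, hc⟩
    refine hx (Algebra.mem_bot.2 ⟨c, ?_⟩)
    rw [hc, mul_comm, IsLocalization.mk'_mul_cancel_right]
  obtain ⟨P, hP, haP⟩ := exists_le_isAssociatedPrime_of_isNoetherianRing A _ ha
  have := hP.isPrime
  obtain ⟨b, hb⟩ := exists_forall_mem_iff_mul_mem hP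
  obtain ⟨r, hrP, hr⟩ := h P (hS2.height_le_one s.2 fun r => by
    rw [hb, Ideal.mem_span_singleton])
  obtain ⟨c, hc⟩ := Algebra.mem_bot.1 hr
  refine hrP (haP ?_)
  rw [Submodule.mem_colon_singleton, ← Submodule.Quotient.mk_smul, Submodule.mem_bot,
    Submodule.Quotient.mk_eq_zero, Ideal.mem_span_singleton]
  refine ⟨c, IsFractionRing.injective A (FractionRing A) ?_⟩
  rw [smul_eq_mul, map_mul, map_mul, hc, mul_comm _ (r • _), Algebra.smul_def, mul_assoc,
    IsLocalization.mk'_spec]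

end SerreS

section Comparison

variable {A : Type*} [CommRing A] [IsNoetherianRing A]

theorem exists_notMem_of_mem_associatedPrimes {J : Ideal A} (hJ : J.IsRadical) {P : Ideal A}
    (hP : P ∈ associatedPrimes A (A ⧸ J)) : ∃ t ∉ P, ∀ a ∈ P, t * a ∈ J := by
  have := hP.isPrime
  obtain ⟨t, ht⟩ := exists_forall_mem_iff_mul_mem hP
  refine ⟨t, fun h => this.ne_top ?_, fun a ha => mul_comm a t ▸ (ht a).1 ha⟩
  have htJ : t ∈ J := hJ ⟨2, by simpa [pow_two] using (ht t).1 h⟩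
  exact (Ideal.eq_top_iff_one P).2 ((ht 1).2 (by simpa using htJ))

theorem minimalPrimes_subset_associatedPrimes_quotient (J : Ideal A) :
    J.minimalPrimes ⊆ associatedPrimes A (A ⧸ J) := by
  simpa [Ideal.annihilator_quotient] using
    Module.associatedPrimes.minimalPrimes_annihilator_subset_associatedPrimes A (A ⧸ J)

theorem le_of_associatedPrimes_subset {J J' : Ideal A} (hJ' : J'.IsRadical)
    (hAss : associatedPrimes A (A ⧸ J') ⊆ associatedPrimes A (A ⧸ J)) : J ≤ J' := by
  rw [← hJ'.radical, ← Ideal.sInf_minimalPrimes]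
  refine le_sInf fun P hP => ?_
  obtain ⟨b, hb⟩ := exists_forall_mem_iff_mul_mem
    (hAss (minimalPrimes_subset_associatedPrimes_quotient J' hP))
  exact fun a ha => (hb a).2 (J.mul_mem_right b ha)

theorem mem_associatedPrimes_of_height_le_one {J : Ideal A}
    (hJ : ∃ g ∈ J, g ∈ nonZeroDivisors A) {P : Ideal A} [P.IsPrime] (hP : P.height ≤ 1)
    (hJP : J ≤ P) : P ∈ associatedPrimes A (A ⧸ J) := by
  obtain ⟨g, hgJ, hg⟩ := hJ
  have : 1 ≤ J.height := (Ideal.one_le_height_span_singleton_of_mem_nonZeroDivisors hg).trans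
    (Ideal.height_mono ((Ideal.span_singleton_le_iff_mem J).2 hgJ))
  exact minimalPrimes_subset_associatedPrimes_quotient J
    (Ideal.mem_minimalPrimes_of_height_le hJP (hP.trans this))

/-- Under `(S₂)`, membership in a ring of the chain can be tested at the primes of height at most
one for integral elements. -/
theorem SerreS.mem_chain_of_forall_height_le_one (hS2 : SerreS A 2)
    [IsNoetherian A (Subalgebra.toSubmodule (integralClosure A (FractionRing A)))]
    {J : Ideal A} (hJ : ∃ g ∈ J, g ∈ nonZeroDivisors A) (i : ℕ) {x : FractionRing A}
    (hx : IsIntegral A x)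
    (h : ∀ (P : Ideal A) [P.IsPrime], P.height ≤ 1 → ∃ s ∉ P, s • x ∈ chain J i) :
    x ∈ chain J i := by
  induction i generalizing x with
  | zero => exact hS2.mem_bot_of_forall_height_le_one h
  | succ i ih =>
    refine mem_endSubalgebra_of_isIntegral (Ideal.radical_isRadical _) hx fun y hy => ?_
    refine ih (hx.mul (chain_le_integralClosure hJ i y.2)) fun P _ hP => ?_
    obtain ⟨s, hsP, hs⟩ := h P hP
    obtain ⟨z, -, hz⟩ := mem_endSubalgebra_iff.1 hs y hy
    refine ⟨s, hsP, ?_⟩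
    rw [← smul_mul_assoc, ← hz]
    exact z.2

theorem SerreS.chain_eq_succ (hS2 : SerreS A 2) {J J' : Ideal A} (hJ : IsTestIdeal J)
    (hJ' : J'.IsRadical)
    (hAss : associatedPrimes A (A ⧸ J') ⊆ associatedPrimes A (A ⧸ J)) {n : ℕ}
    (hn : chain J n = chain J (n + 1)) : chain J' n = chain J' (n + 1) := by
  have := isNoetherian_integralClosure hJ
  have hle := le_of_associatedPrimes_subset hJ' hAss
  have hg := hJ.exists_nonZeroDivisor
  have hg' : ∃ g ∈ J', g ∈ nonZeroDivisors A := hg.imp fun g h => ⟨hle h.1, h.2⟩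
  -- The chain of `J'` agrees at `P` with a chain that is stationary from `n` on.
  have key : ∀ (P : Ideal A) [P.IsPrime], P.height ≤ 1 → ∃ I : Ideal A,
      (∃ g ∈ I, g ∈ nonZeroDivisors A) ∧ chain I n = chain I (n + 1) ∧
        ∃ t ∉ P, (∀ a ∈ J', t * a ∈ I) ∧ ∀ a ∈ I, t * a ∈ J' := by
    intro P _ hP
    by_cases hJP : J' ≤ P
    · obtain ⟨t, htP, ht⟩ := exists_notMem_of_mem_associatedPrimes hJ.isRadical
        (hAss (mem_associatedPrimes_of_height_le_one hg' hP hJP))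
      exact ⟨J, hg, hn, t, htP, fun a ha => ht a (hJP ha),
        fun a ha => J'.mul_mem_left t (hle ha)⟩
    · obtain ⟨t, htJ, htP⟩ := SetLike.not_le_iff_exists.1 hJP
      exact ⟨⊤, ⟨1, trivial, one_mem _⟩, by rw [chain_top, chain_top], t, htP,
        fun _ _ => trivial, fun a _ => J'.mul_mem_right a htJ⟩
  refine le_antisymm (chain_mono J' n.le_succ) fun x hx => ?_
  refine hS2.mem_chain_of_forall_height_le_one hg' n (chain_le_integralClosure hg' _ hx)
    fun P _ hP => ?_
  obtain ⟨I, hI, hIn, t, htP, ht₁, ht₂⟩ := key P hP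
  obtain ⟨s, hsP, hs, -⟩ := exists_smul_mem_chain hg' hI htP ht₁ ht₂ (n + 1)
  obtain ⟨r, hrP, -, hr⟩ := exists_smul_mem_chain hg' hI htP ht₁ ht₂ n
  refine ⟨r * s, ?_, ?_⟩
  · simp [Ideal.IsPrime.mul_mem_iff_mem_or_mem, hsP, hrP]
  · rw [mul_smul]
    exact hr _ (hIn ▸ hs x hx)

end Comparison

end GLS

theorem mainTheorem3 {A : Type*} [CommRing A] [IsNoetherianRing A] [IsReduced A]
    (hdim : GLS.IsEquidimensional A) (hS2 : GLS.SerreS A 2)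
    (J : Ideal A) (hJ : GLS.IsTestIdeal J)
    (J' : Ideal A) (hJ' : J'.IsRadical)
    (hAss : associatedPrimes A (A ⧸ J') ⊆ associatedPrimes A (A ⧸ J)) :
    GLS.numSteps J' ≤ GLS.numSteps J ∧ GLS.numSteps J < ⊤ := by
  refine ⟨le_iInf₂ fun n hn => iInf₂_le n (hS2.chain_eq_succ hJ hJ' hAss hn), ?_⟩
  have := GLS.isNoetherian_integralClosure hJ
  obtain ⟨n, hn⟩ := GLS.exists_chain_eq_succ hJ.exists_nonZeroDivisor
  exact (iInf₂_le n hn).trans_lt (ENat.natCast_lt_top n)
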